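/- All graphs are finite, simple and undirected. For a graph $G=(V,E)$ let $\mathcal{S}(G)$ be the set of real symmetric matrices $A=[a_{ij}]_{i,j\in V}$ such that, for all $i\neq j$, $a_{ij}\neq 0$ if and only if $ij\in E$ (the diagonal entries are arbitrary). A symmetric matrix $A$ has the Strong Spectral Property (SSP) if the only real symmetric matrix $X$ with $A\circ X=O$, $I\circ X=O$ and $AX-XA=O$ is $X=O$, where $\circ$ is the entrywise product. Write $G\in G^{SSP}$ if every $A\in\mathcal{S}(G)$ has the SSP. For a vertex $v$ of $G$, let $dup(G,v)$ be the graph obtained from $G$ by adding a new vertex adjacent to exactly the vertices of $N_G(v)$, and let $jdup(G,v)$ be the graph obtained from $G$ by adding a new vertex adjacent to exactly the vertices of $N_G(v)\cup\{v\}$. **Theorem.** Let $G$ be a graph and let $v\in V(G)$ be a pendant vertex of $G$ (a vertex of degree $1$). Let $G'$ be either $dup(G,v)$ or $jdup(G,v)$. Then $G'\in G^{SSP}$ if and only if $G$ is a path $P_n$ for some $n$. -/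

import Mathlib

open scoped Matrix

namespace SSPGraph

/-- `SymmMatrices G` is the set `S(G)` of real symmetric matrices whose off-diagonal nonzero
pattern is given by the edges of `G` (the diagonal entries are free). -/
def SymmMatrices {V : Type*} (G : SimpleGraph V) : Set (Matrix V V ℝ) :=
  {A | A.IsSymm ∧ ∀ i j, i ≠ j → (A i j ≠ 0 ↔ G.Adj i j)}

/-- The Strong Spectral Property: the only symmetric `X` with `A ∘ X = O`, `I ∘ X = O` and
`[A, X] = O` is `X = O`; here `⊙` is the entrywise product and `⁅A, X⁆ = A * X - X * A`. -/
def HasSSP {V : Type*} [Fintype V] [DecidableEq V] (A : Matrix V V ℝ) : Prop :=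
  ∀ X : Matrix V V ℝ, X.IsSymm → A ⊙ X = 0 → (1 : Matrix V V ℝ) ⊙ X = 0 → ⁅A, X⁆ = 0 → X = 0

/-- Membership of a graph in the class `G^SSP`. -/
def InGSSP {V : Type*} [Fintype V] [DecidableEq V] (G : SimpleGraph V) : Prop :=
  ∀ A ∈ SymmMatrices G, HasSSP A

/-- Adjacency after adding to `G` a new vertex `none` with the same neighbours as `v`. -/
def dupAdj {V : Type*} (G : SimpleGraph V) (v : V) : Option V → Option V → Prop
  | some a, some b => G.Adj a b
  | some a, none => G.Adj v a
  | none, some b => G.Adj v b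
  | none, none => False

theorem dupAdj_symm {V : Type*} (G : SimpleGraph V) (v : V) (x y : Option V)
    (h : dupAdj G v x y) : dupAdj G v y x := by
  cases x <;> cases y <;> simp_all [dupAdj, SimpleGraph.adj_comm]

theorem dupAdj_irrefl {V : Type*} (G : SimpleGraph V) (v : V) (x : Option V) :
    ¬ dupAdj G v x x := by
  cases x <;> simp [dupAdj]

/-- `dup G v`: duplicate `v` without an edge. The new vertex is `none`. -/
def dup {V : Type*} (G : SimpleGraph V) (v : V) : SimpleGraph (Option V) where
  Adj := dupAdj G v
  symm := ⟨dupAdj_symm G v⟩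
  loopless := ⟨dupAdj_irrefl G v⟩

/-- `jdup G v`: duplicate `v` with an edge, so the new vertex is also adjacent to `v`. -/
def jdup {V : Type*} (G : SimpleGraph V) (v : V) : SimpleGraph (Option V) :=
  dup G v ⊔ SimpleGraph.edge none (some v)

/-- `G` is a path, i.e. isomorphic to some `P_n`. -/
def IsPathGraph {V : Type*} (G : SimpleGraph V) : Prop :=
  ∃ n : ℕ, Nonempty (G ≃g SimpleGraph.pathGraph n)

end SSPGraph

/-!
Let `v` be a pendant vertex of `G`, and let `G'` be `G` with `v` doubled.

If `G` is a path, `v` is one of its ends, and `G'` is a path with its first vertex doubled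
(`IsTwinLevel`). Let `X` commute with a pattern matrix `A` of `G'` and vanish on the diagonal and
on the edges. Everything except the entry at the two twins vanishes at level distance at most `1`.
The entries at distance `2` vanish one after the other from the far end of the path, and the
equations at the doubled end then kill the entry at the twins (`IsTwinLevel.apply_twins_eq_zero`).
From there an induction on the level distance gives `X = 0` (`IsTwinLevel.eq_zero_of_near`).

If `G` is not a path, follow `G` from `v` along vertices with only one continuation
(`IsInitialPath`). This stops at a vertex whose number of neighbours off the path is not `1`, with
vertices off the path left over. So there is a vector `z`, supported exactly off the path, whose
sum over the neighbours of each path vertex is zero. A suitable diagonal makes `z` a kernel vector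
of a pattern matrix of `G`, and after doubling `v` the difference `y` of the twins is a kernel vector
as well. As `z` vanishes at `v` and at its neighbour, the matrix `y zᵀ + z yᵀ` shows that the strong
spectral property fails (`not_hasSSP_submatrix`). Disconnected graphs need no separate treatment.
-/

namespace SSPGraph

/-! ### Commuting matrices on a path with a doubled end -/

/-- `ℓ` exhibits `H` as a path whose first vertex is doubled into `v` and `w`: level `0` is
`{v, w}`, each other level is at most one vertex, edges join vertices whose levels differ by at
most one, and vertices on consecutive levels are always joined. Whether `v` and `w` are adjacent
is left open. -/
structure IsTwinLevel {W : Type*} (H : SimpleGraph W) (ℓ : W → ℕ) (v w : W) : Prop where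
  ne : v ≠ w
  left : ℓ v = 0
  right : ℓ w = 0
  eq_or_eq : ∀ x, ℓ x = 0 → x = v ∨ x = w
  inj : ∀ x y, ℓ x = ℓ y → ℓ x ≠ 0 → x = y
  exists_pred : ∀ y m, ℓ y = m + 1 → ∃ x, ℓ x = m
  exists_one : ∃ c, ℓ c = 1
  adj : ∀ x y, ℓ y = ℓ x + 1 → H.Adj x y
  near : ∀ x y, H.Adj x y → ℓ x ≤ ℓ y + 1 ∧ ℓ y ≤ ℓ x + 1

namespace IsTwinLevel

variable {W : Type*} {H : SimpleGraph W} {ℓ : W → ℕ} {v w : W}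
  {A X : Matrix W W ℝ}

theorem apply_eq_zero_of_far (h : IsTwinLevel H ℓ v w) (hA : A ∈ SymmMatrices H) (x y : W)
    (hxy : ℓ x + 1 < ℓ y ∨ ℓ y + 1 < ℓ x) : A x y = 0 := by
  by_contra h0
  have hne : x ≠ y := by rintro rfl; omega
  have := h.near x y ((hA.2 x y hne).1 h0)
  omega

theorem apply_ne_zero (h : IsTwinLevel H ℓ v w) (hA : A ∈ SymmMatrices H) (x y : W)
    (hxy : ℓ y = ℓ x + 1) : A x y ≠ 0 :=
  (hA.2 x y (by rintro rfl; omega)).2 (h.adj x y hxy)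

variable [Fintype W]

/-- A matrix commuting with `A` and vanishing at level distance at most `1` is zero: at each
larger level distance the entries are killed one after the other, starting from level `0`. -/
theorem eq_zero_of_near (h : IsTwinLevel H ℓ v w) (hA : A ∈ SymmMatrices H) (hX : X.IsSymm)
    (hc : A * X = X * A)
    (hX1 : ∀ x y, ℓ x ≤ ℓ y + 1 → ℓ y ≤ ℓ x + 1 → X x y = 0) : X = 0 := by
  have key : ∀ d x y, ℓ x ≤ ℓ y + (d + 1) → ℓ y ≤ ℓ x + (d + 1) → X x y = 0 := by
    intro d
    induction d with
    | zero => exact hX1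
    | succ d ihd =>
      have inner : ∀ n x y, ℓ x = n → ℓ y = ℓ x + (d + 2) → X x y = 0 := by
        intro n
        induction n using Nat.strong_induction_on with
        | _ n ihn =>
          intro x y hx hy
          obtain ⟨y', hy'⟩ := h.exists_pred y (ℓ x + (d + 1)) (by omega)
          have e := congrFun (congrFun hc x) y'
          rw [Matrix.mul_apply, Matrix.mul_apply] at e
          rw [Finset.sum_eq_zero, Finset.sum_eq_single y] at e
          · have := h.apply_ne_zero hA y' y (by omega)
            rw [hA.1.apply] at e
            simpa [this] using e.symm
          · intro k _ hk
            by_cases hf : ℓ k + 1 < ℓ y' ∨ ℓ y' + 1 < ℓ k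
            · rw [h.apply_eq_zero_of_far hA k y' hf, mul_zero]
            · have : ℓ k ≠ ℓ y := fun hky => hk (h.inj k y hky (by omega))
              rw [ihd x k (by omega) (by omega), zero_mul]
          · simp
          · intro k _
            by_cases hf : ℓ x + 1 < ℓ k ∨ ℓ k + 1 < ℓ x
            · rw [h.apply_eq_zero_of_far hA x k hf, zero_mul]
            · by_cases hk : ℓ k < ℓ x
              · rw [ihn (ℓ k) (by omega) k y' rfl (by omega), mul_zero]
              · rw [ihd k y' (by omega) (by omega), mul_zero]
      intro x y h1 h2
      rcases lt_trichotomy (ℓ y) (ℓ x + (d + 2)) with h3 | h3 | h3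
      · rcases lt_trichotomy (ℓ x) (ℓ y + (d + 2)) with h4 | h4 | h4
        · exact ihd x y (by omega) (by omega)
        · rw [← hX.apply]
          exact inner _ y x rfl h4
        · omega
      · exact inner _ x y rfl h3
      · omega
  ext x y
  exact key (ℓ x + ℓ y) x y (by omega) (by omega)

/-- Entries at level distance `2` away from the doubled end vanish: they are killed one after the
other, starting from the far end of the path. -/
theorem apply_eq_zero_of_add_two (h : IsTwinLevel H ℓ v w) (hA : A ∈ SymmMatrices H)
    (hc : A * X = X * A) (h1 : ∀ x y, ℓ x ≠ 0 → ℓ y ≠ 0 → ℓ x ≤ ℓ y + 1 → ℓ y ≤ ℓ x + 1 → X x y = 0)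
    (x y : W) (hx : ℓ x ≠ 0) (hxy : ℓ y = ℓ x + 2) : X x y = 0 := by
  obtain ⟨N, hN⟩ : ∃ N, ∀ x, ℓ x ≤ N :=
    ⟨∑ x, ℓ x, fun x => Finset.single_le_sum (f := ℓ) (fun _ _ => Nat.zero_le _) (Finset.mem_univ x)⟩
  induction hm : N - ℓ x using Nat.strong_induction_on generalizing x y with
  | _ m ih =>
    obtain ⟨c, hcl⟩ := h.exists_pred y (ℓ x + 1) (by omega)
    have e := congrFun (congrFun hc c) y
    rw [Matrix.mul_apply, Matrix.mul_apply] at e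
    rw [Finset.sum_eq_single x, Finset.sum_eq_zero] at e
    · have := h.apply_ne_zero hA x c (by omega)
      rw [hA.1.apply] at e
      simpa [this] using e
    · intro k _
      by_cases hf : ℓ k + 1 < ℓ y ∨ ℓ y + 1 < ℓ k
      · rw [h.apply_eq_zero_of_far hA k y hf, mul_zero]
      · by_cases hk : ℓ k = ℓ c + 2
        · have := hN k
          rw [ih (N - ℓ c) (by omega) c k (by omega) hk rfl, zero_mul]
        · rw [h1 c k (by omega) (by omega) (by omega) (by omega), zero_mul]
    · intro k _ hk
      by_cases hf : ℓ c + 1 < ℓ k ∨ ℓ k + 1 < ℓ c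
      · rw [h.apply_eq_zero_of_far hA c k hf, zero_mul]
      · have : ℓ k ≠ ℓ x := fun hkx => hk (h.inj k x hkx (by omega))
        rw [h1 k y (by omega) (by omega) (by omega) (by omega), mul_zero]
    · simp

/-- When the twins `v` and `w` are adjacent this repeats a hypothesis. Otherwise `X v w` is tied to
the entries of `X` between the twins and level `2`, if there is such a level, and
`apply_eq_zero_of_add_two` supplies the equation that makes the resulting system nonsingular. -/
theorem apply_twins_eq_zero (h : IsTwinLevel H ℓ v w) (hA : A ∈ SymmMatrices H) (hX : X.IsSymm)
    (hc : A * X = X * A) (hd : ∀ x, X x x = 0) (hXA : ∀ x y, H.Adj x y → X x y = 0) :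
    X v w = 0 := by
  have hs : ∀ x y, ℓ y = ℓ x + 1 → X x y = 0 := fun x y hxy => hXA x y (h.adj x y hxy)
  have hs' : ∀ x y, ℓ x = ℓ y + 1 → X x y = 0 := fun x y hxy => hXA x y (h.adj y x hxy).symm
  have h1 : ∀ x y, ℓ x ≠ 0 → ℓ y ≠ 0 → ℓ x ≤ ℓ y + 1 → ℓ y ≤ ℓ x + 1 → X x y = 0 := by
    intro x y hx hy h2 h3
    rcases lt_trichotomy (ℓ x) (ℓ y) with h4 | h4 | h4
    · exact hs x y (by omega)
    · rw [h.inj x y h4 hx, hd]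
    · exact hs' x y (by omega)
  obtain ⟨c, hcl⟩ := h.exists_one
  have hv := h.left
  have hw := h.right
  have hvc := h.apply_ne_zero hA v c (by omega)
  have hwc := h.apply_ne_zero hA w c (by omega)
  -- The left side of the `(x, c)` entry of `A * X = X * A` vanishes for `x` on level `0`.
  have row : ∀ x, ℓ x = 0 → ∑ k, X x k * A k c = 0 := by
    intro x hx
    have e := congrFun (congrFun hc x) c
    rw [Matrix.mul_apply, Matrix.mul_apply] at e
    rw [← e]
    refine Finset.sum_eq_zero fun k _ => ?_
    by_cases hf : ℓ x + 1 < ℓ k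
    · rw [h.apply_eq_zero_of_far hA x k (Or.inl hf), zero_mul]
    · by_cases hk : ℓ k = 0
      · rw [hs k c (by omega), mul_zero]
      · rw [h.inj k c (by omega) hk, hd, mul_zero]
  by_cases he : ∃ e, ℓ e = 2
  · obtain ⟨e, hel⟩ := he
    have hce := h.apply_ne_zero hA c e (by omega)
    have row' : ∀ x y, x ≠ y → (∀ k, ℓ k = 0 → k = x ∨ k = y) → ℓ x = 0 → ℓ y = 0 →
        X x y * A y c + X x e * A e c = 0 := by
      intro x y hxy hk0 hx hy
      have e1 := row x hx
      rwa [Finset.sum_eq_add_of_mem y e (Finset.mem_univ _) (Finset.mem_univ _)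
        (by rintro rfl; omega)] at e1
      rintro k - ⟨hky, hke⟩
      by_cases hf : ℓ c + 1 < ℓ k
      · rw [h.apply_eq_zero_of_far hA k c (Or.inr hf), mul_zero]
      · have hk2 : ℓ k ≠ 2 := fun hk2 => hke (h.inj k e (by omega) (by omega))
        by_cases hk : ℓ k = 0
        · rcases hk0 k hk with rfl | rfl
          · rw [hd, zero_mul]
          · exact absurd rfl hky
        · rw [hs x k (by omega), zero_mul]
    have ev := row' v w h.ne h.eq_or_eq hv hw
    have ew := row' w v h.ne.symm (fun k hk => (h.eq_or_eq k hk).symm) hw hv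
    have ec : A c v * X v e + A c w * X w e = 0 := by
      have e1 := congrFun (congrFun hc c) e
      rw [Matrix.mul_apply, Matrix.mul_apply] at e1
      rw [Finset.sum_eq_add_of_mem v w (Finset.mem_univ _) (Finset.mem_univ _) h.ne,
        Finset.sum_eq_zero] at e1
      · exact e1
      · intro k _
        by_cases hf : ℓ k + 1 < ℓ e ∨ ℓ e + 1 < ℓ k
        · rw [h.apply_eq_zero_of_far hA k e hf, mul_zero]
        · by_cases hk : ℓ k = 3
          · rw [h.apply_eq_zero_of_add_two hA hc h1 c k (by omega) (by omega), zero_mul]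
          · rw [h1 c k (by omega) (by omega) (by omega) (by omega), zero_mul]
      · rintro k - ⟨hkv, hkw⟩
        by_cases hf : ℓ c + 1 < ℓ k
        · rw [h.apply_eq_zero_of_far hA c k (Or.inl hf), zero_mul]
        · have : ℓ k ≠ 0 := fun hk => (h.eq_or_eq k hk).elim hkv hkw
          rw [h1 k e (by omega) (by omega) (by omega) (by omega), mul_zero]
    rw [hA.1.apply v c, hA.1.apply w c] at ec
    rw [hX.apply] at ew
    -- Eliminating `X v e` and `X w e` counts `X v w` twice, with the same sign.
    have : A v c * A w c * X v w = 0 := by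
      linear_combination (1 / 2) * A v c * ev + (1 / 2) * A w c * ew - (1 / 2) * A e c * ec
    simpa [hvc, hwc] using this
  · have e1 := row v hv
    rw [Finset.sum_eq_single w] at e1
    · simpa [hwc] using e1
    · intro k _ hk
      by_cases hf : ℓ c + 1 < ℓ k
      · rw [h.apply_eq_zero_of_far hA k c (Or.inr hf), mul_zero]
      · have hk2 : ℓ k ≠ 2 := fun hk2 => he ⟨k, hk2⟩
        by_cases hk0 : ℓ k = 0
        · rcases h.eq_or_eq k hk0 with rfl | rfl
          · rw [hd, zero_mul]
          · exact absurd rfl hk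
        · rw [hs v k (by omega), zero_mul]
    · simp

theorem inGSSP [DecidableEq W] (h : IsTwinLevel H ℓ v w) : InGSSP H := by
  intro A hA X hX hAX hIX hc
  rw [Ring.lie_def, sub_eq_zero] at hc
  have hd : ∀ x, X x x = 0 := fun x => by
    simpa [Matrix.hadamard_apply] using congrFun (congrFun hIX x) x
  have hXA : ∀ x y, H.Adj x y → X x y = 0 := fun x y hxy => by
    have := congrFun (congrFun hAX x) y
    simpa [Matrix.hadamard_apply, (hA.2 x y hxy.ne).2 hxy] using this
  have hvw := h.apply_twins_eq_zero hA hX hc hd hXA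
  refine h.eq_zero_of_near hA hX hc fun x y h1 h2 => ?_
  rcases lt_trichotomy (ℓ x) (ℓ y) with h3 | h3 | h3
  · exact hXA x y (h.adj x y (by omega))
  · by_cases h0 : ℓ x = 0
    · rcases h.eq_or_eq x h0 with rfl | rfl <;> rcases h.eq_or_eq y (by omega) with rfl | rfl
      · exact hd _
      · exact hvw
      · rw [hX.apply, hvw]
      · exact hd _
    · rw [h.inj x y h3 h0, hd]
  · exact hXA x y (h.adj y x (by omega)).symm

end IsTwinLevel

/-! ### Duplicating the end of a path -/

/-- A path can be numbered starting from a given pendant vertex. -/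
theorem IsPathGraph.exists_pos {V : Type*} {G : SimpleGraph V} (hG : IsPathGraph G) {v u : V}
    (hu : ∀ x, G.Adj v x ↔ x = u) :
    ∃ h : V → ℕ, Function.Injective h ∧ h v = 0 ∧ (∀ y m, h y = m + 1 → ∃ x, h x = m) ∧
      ∀ x y, G.Adj x y ↔ h x + 1 = h y ∨ h y + 1 = h x := by
  obtain ⟨n, ⟨e⟩⟩ := hG
  have hadj : ∀ x y, G.Adj x y ↔ (e x).val + 1 = (e y).val ∨ (e y).val + 1 = (e x).val := by
    intro x y
    rw [← e.map_adj_iff, SimpleGraph.pathGraph_adj]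
  by_cases h0 : (e v).val = 0
  · refine ⟨fun x => (e x).val, fun x y hxy => e.injective (Fin.ext hxy), h0, ?_, hadj⟩
    intro y m hy
    dsimp only at hy
    have := (e y).isLt
    exact ⟨e.symm ⟨m, by omega⟩, by simp⟩
  · have hl : (e v).val + 1 = n := by
      by_contra hl
      have hlt := (e v).isLt
      have h1 := (hu (e.symm ⟨(e v).val - 1, by omega⟩)).1
        ((hadj _ _).2 (by simp only [RelIso.apply_symm_apply]; omega))
      have h2 := (hu (e.symm ⟨(e v).val + 1, by omega⟩)).1
        ((hadj _ _).2 (Or.inl (by simp)))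
      have h3 := e.symm.injective (h1.trans h2.symm)
      simp only [Fin.mk.injEq] at h3
      omega
    refine ⟨fun x => n - 1 - (e x).val, ?_, by simp only; omega, ?_, ?_⟩
    · intro x y hxy
      have := (e x).isLt
      have := (e y).isLt
      simp only at hxy
      exact e.injective (Fin.ext (by omega))
    · intro y m hy
      dsimp only at hy
      have := (e y).isLt
      exact ⟨e.symm ⟨n - 1 - m, by omega⟩, by simp only [RelIso.apply_symm_apply]; omega⟩
    · intro x y
      have := (e x).isLt
      have := (e y).isLt
      rw [hadj]
      dsimp only
      omega

theorem jdup_adj {V : Type*} (G : SimpleGraph V) (v : V) (x y : Option V) :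
    (jdup G v).Adj x y ↔
      (dup G v).Adj x y ∨ (x = none ∧ y = some v) ∨ (x = some v ∧ y = none) := by
  simp only [jdup, SimpleGraph.sup_adj, SimpleGraph.edge_adj]
  constructor
  · rintro (h | ⟨h | h, -⟩)
    · exact Or.inl h
    · exact Or.inr (Or.inl ⟨h.1, h.2⟩)
    · exact Or.inr (Or.inr ⟨h.1, h.2⟩)
  · rintro (h | ⟨rfl, rfl⟩ | ⟨rfl, rfl⟩)
    · exact Or.inl h
    · exact Or.inr (by simp)
    · exact Or.inr (by simp)

theorem IsPathGraph.exists_isTwinLevel {V : Type*} {G : SimpleGraph V} (hG : IsPathGraph G)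
    {v u : V} (hu : ∀ x, G.Adj v x ↔ x = u) :
    ∃ ℓ, IsTwinLevel (dup G v) ℓ (some v) none ∧ IsTwinLevel (jdup G v) ℓ (some v) none := by
  obtain ⟨h, hinj, hv, hpred, hadj⟩ := hG.exists_pos hu
  have hd : IsTwinLevel (dup G v) (fun x => h (x.getD v)) (some v) none :=
    { ne := by simp
      left := hv
      right := hv
      eq_or_eq := by
        rintro (_ | x) hx
        · exact Or.inr rfl
        · exact Or.inl (congrArg some (hinj (hx.trans hv.symm)))
      inj := by
        rintro (_ | x) (_ | y) hxy h0
        · rfl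
        · exact absurd hv h0
        · exact absurd (hxy.trans hv) h0
        · exact congrArg some (hinj hxy)
      exists_pred := fun y m hy => (hpred _ m hy).imp' some fun _ hx => hx
      exists_one := ⟨some u, by
        have := (hadj v u).1 ((hu u).2 rfl)
        simp only [Option.getD_some]
        omega⟩
      adj := by
        rintro (_ | x) (_ | y) hxy <;> simp only [Option.getD_some, Option.getD_none] at hxy
        · omega
        · exact (hadj v y).2 (Or.inl hxy.symm)
        · omega
        · exact (hadj x y).2 (Or.inl hxy.symm)
      near := by
        rintro (_ | x) (_ | y) hxy <;> simp only [Option.getD_some, Option.getD_none]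
        · omega
        · have := (hadj v y).1 hxy
          omega
        · have := (hadj v x).1 hxy
          omega
        · have := (hadj x y).1 hxy
          omega }
  refine ⟨_, hd, { hd with adj := ?_, near := ?_ }⟩
  · exact fun x y hxy => (jdup_adj G v x y).2 (Or.inl (hd.adj x y hxy))
  · intro x y hxy
    rcases (jdup_adj G v x y).1 hxy with h1 | ⟨rfl, rfl⟩ | ⟨rfl, rfl⟩
    · exact hd.near x y h1
    · simp
    · simp

/-! ### Matrices without the strong spectral property -/

/-- If the pattern matrix `W` of `G` kills a nonzero `z` which vanishes at `v` and at its
neighbours, then doubling row and column `v` of `W` gives a matrix without the SSP: its kernel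
contains `z` and the difference `y` of the twins, and `y zᵀ + z yᵀ` violates the property. -/
theorem not_hasSSP_submatrix {V : Type*} [Fintype V] [DecidableEq V] {W : Matrix V V ℝ}
    (hW : W.IsSymm) {v : V} {z : V → ℝ} (hz : z ≠ 0) (hWz : W.mulVec z = 0) (hv : z v = 0)
    (hvW : ∀ x, z x ≠ 0 → W v x = 0) :
    ¬ HasSSP (W.submatrix (fun x : Option V => x.getD v) (fun x : Option V => x.getD v)) := by
  intro hA
  set A := W.submatrix (fun x : Option V => x.getD v) (fun x : Option V => x.getD v) with hAdef
  have hAs : A.IsSymm := hW.submatrix _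
  let z' : Option V → ℝ := fun x => x.elim 0 z
  let y : Option V → ℝ := fun x => x.elim (-1) (Pi.single v 1)
  have hAz : A.mulVec z' = 0 := by
    ext x
    have := congrFun hWz (x.getD v)
    simpa [Matrix.mulVec, dotProduct, Fintype.sum_option, A, z'] using this
  have hAy : A.mulVec y = 0 := by
    ext x
    simp [Matrix.mulVec, dotProduct, Fintype.sum_option, A, y, Pi.single_apply]
  have hzA : Matrix.vecMul z' A = 0 := by rw [← Matrix.mulVec_transpose, hAs.eq, hAz]
  have hyA : Matrix.vecMul y A = 0 := by rw [← Matrix.mulVec_transpose, hAs.eq, hAy]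
  have hyz : ∀ x t, y x * z' t ≠ 0 → x.getD v = v ∧ W v (t.getD v) = 0 ∧ x ≠ t := by
    rintro (_ | x) (_ | t) h <;> simp [y, z', Pi.single_apply] at h ⊢
    · exact hvW t h
    · obtain ⟨rfl, h2⟩ := h
      refine ⟨rfl, hvW t h2, ?_⟩
      rintro rfl
      exact h2 hv
  have hX := hA (Matrix.vecMulVec y z' + Matrix.vecMulVec z' y) ?_ ?_ ?_ ?_
  · obtain ⟨t, ht⟩ := Function.ne_iff.1 hz
    have := congrFun (congrFun hX none) (some t)
    simp [Matrix.vecMulVec_apply, y, z'] at this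
    exact ht this
  · rw [Matrix.IsSymm, Matrix.transpose_add, Matrix.transpose_vecMulVec,
      Matrix.transpose_vecMulVec, add_comm]
  · ext x t
    simp only [Matrix.hadamard_apply, Matrix.add_apply, Matrix.vecMulVec_apply, Matrix.zero_apply]
    have h1 : A x t * (y x * z' t) = 0 := by
      by_cases h : y x * z' t = 0
      · rw [h, mul_zero]
      · obtain ⟨h2, h3, -⟩ := hyz x t h
        simp [A, h2, h3]
    have h2 : A x t * (y t * z' x) = 0 := by
      by_cases h : y t * z' x = 0
      · rw [h, mul_zero]
      · obtain ⟨h2, h3, -⟩ := hyz t x h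
        rw [← hAs.apply]
        simp [A, h2, h3]
    linear_combination h1 + h2
  · ext x t
    simp only [Matrix.hadamard_apply, Matrix.add_apply, Matrix.vecMulVec_apply, Matrix.zero_apply]
    by_cases hxt : x = t
    · subst hxt
      have h : y x * z' x = 0 := by
        by_contra h
        exact (hyz x x h).2.2 rfl
      rw [mul_comm (z' x), h]
      simp
    · rw [Matrix.one_apply_ne hxt, zero_mul]
  · rw [Ring.lie_def, mul_add, add_mul, Matrix.mul_vecMulVec, Matrix.mul_vecMulVec,
      Matrix.vecMulVec_mul, Matrix.vecMulVec_mul, hAz, hAy, hzA, hyA]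
    simp

/-- The diagonal of `W` is chosen so that the adjacency matrix becomes singular with kernel
vector `z`; where `z` vanishes it is free, and is set to `0` or `1` so that the doubled vertices
are non-adjacent or adjacent. -/
theorem not_inGSSP_of_adjMatrix_mulVec {V : Type*} [Fintype V] [DecidableEq V] {G : SimpleGraph V}
    [DecidableRel G.Adj] {v : V} {z : V → ℝ} (hz : z ≠ 0)
    (hGz : ∀ x, z x = 0 → (G.adjMatrix ℝ).mulVec z x = 0) (hv : z v = 0)
    (hvz : ∀ x, G.Adj v x → z x = 0) : ¬ InGSSP (dup G v) ∧ ¬ InGSSP (jdup G v) := by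
  let W : ℝ → Matrix V V ℝ := fun ε => G.adjMatrix ℝ +
    Matrix.diagonal fun x => if z x = 0 then ε else -(G.adjMatrix ℝ).mulVec z x / z x
  have hWs : ∀ ε, (W ε).IsSymm := fun ε =>
    (G.isSymm_adjMatrix).add (Matrix.isSymm_diagonal _)
  have hWo : ∀ ε x y, x ≠ y → (W ε x y ≠ 0 ↔ G.Adj x y) := by
    intro ε x y hxy
    simp [W, hxy, SimpleGraph.adjMatrix_apply]
  have hWv : ∀ ε, W ε v v = ε := by
    intro ε
    simp [W, hv]
  have hWz : ∀ ε, (W ε).mulVec z = 0 := by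
    intro ε
    ext x
    rw [Matrix.add_mulVec, Pi.add_apply, Matrix.mulVec_diagonal]
    by_cases hx : z x = 0
    · simp [hGz x hx, hx]
    · rw [if_neg hx, div_mul_cancel₀ _ hx]
      simp
  have hvW : ∀ ε x, z x ≠ 0 → W ε v x = 0 := by
    intro ε x hx
    have hne : v ≠ x := by
      rintro rfl
      exact hx hv
    by_contra h
    exact hx (hvz x ((hWo ε v x hne).1 h))
  constructor
  · intro h
    refine not_hasSSP_submatrix (hWs 0) hz (hWz 0) hv (hvW 0) (h _ ⟨(hWs 0).submatrix _, ?_⟩)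
    rintro (_ | x) (_ | y) hxy
    · exact absurd rfl hxy
    · by_cases hy : v = y
      · subst hy
        simp [hWv, dup, dupAdj]
      · exact hWo 0 v y hy
    · by_cases hx : x = v
      · subst hx
        simp [hWv, dup, dupAdj]
      · exact (hWo 0 x v hx).trans (G.adj_comm x v)
    · exact hWo 0 x y (fun h => hxy (congrArg some h))
  · intro h
    refine not_hasSSP_submatrix (hWs 1) hz (hWz 1) hv (hvW 1) (h _ ⟨(hWs 1).submatrix _, ?_⟩)
    rintro (_ | x) (_ | y) hxy <;> rw [jdup_adj]
    · exact absurd rfl hxy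
    · by_cases hy : v = y
      · subst hy
        simp [hWv]
      · simpa [Ne.symm hy, dup, dupAdj] using hWo 1 v y hy
    · by_cases hx : x = v
      · subst hx
        simp [hWv]
      · simpa [hx, dup, dupAdj] using (hWo 1 x v hx).trans (G.adj_comm x v)
    · simpa [dup, dupAdj] using hWo 1 x y (fun h => hxy (congrArg some h))

/-! ### Following a graph from a pendant vertex -/

/-- A finite set that is not a singleton carries a nowhere zero function of sum zero. -/
theorem exists_ne_zero_sum_eq_zero {V : Type*} (N : Finset V) (hN : N.card ≠ 1) :
    ∃ b : V → ℝ, (∀ x, b x ≠ 0) ∧ ∑ x ∈ N, b x = 0 := by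
  classical
  rcases N.eq_empty_or_nonempty with rfl | ⟨a, ha⟩
  · exact ⟨fun _ => 1, by simp, by simp⟩
  · have hpos : 0 < (N.erase a).card := by
      have := Finset.card_erase_add_one ha
      omega
    have hpos' : (0 : ℝ) < (N.erase a).card := by exact_mod_cast hpos
    refine ⟨fun x => if x = a then -((N.erase a).card : ℝ) else 1, ?_, ?_⟩
    · intro x
      by_cases hx : x = a
      · dsimp only
        rw [if_pos hx]
        exact neg_ne_zero.2 hpos'.ne'
      · simp [hx]
    · rw [← Finset.add_sum_erase N _ ha, if_pos rfl,
        Finset.sum_congr rfl fun x hx => if_neg (Finset.ne_of_mem_erase hx)]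
      simp

/-- `f 0, …, f k` is an induced path of `G` starting at `v` which can only be left through its
last vertex `f k`. The values of `f` beyond `k` are irrelevant. -/
structure IsInitialPath {V : Type*} (G : SimpleGraph V) (v : V) (f : ℕ → V) (k : ℕ) : Prop where
  zero : f 0 = v
  inj : ∀ i j, i ≤ k → j ≤ k → f i = f j → i = j
  adj : ∀ i j, i ≤ k → j ≤ k → (G.Adj (f i) (f j) ↔ i + 1 = j ∨ j + 1 = i)
  closed : ∀ i, i < k → ∀ x, G.Adj (f i) x → ∃ j ≤ k, f j = x

theorem IsInitialPath.lt_card {V : Type*} [Fintype V] {G : SimpleGraph V} {v : V} {f : ℕ → V}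
    {k : ℕ} (h : IsInitialPath G v f k) : k < Fintype.card V := by
  have := Fintype.card_le_of_injective (fun i : Fin (k + 1) => f i) fun i j hij =>
    Fin.ext (h.inj i j (by omega) (by omega) hij)
  simpa using this

theorem IsInitialPath.snoc {V : Type*} [DecidableEq V] {G : SimpleGraph V} {v : V} {f : ℕ → V}
    {k : ℕ} (h : IsInitialPath G v f k) {x : V} (hx : ∀ j ≤ k, f j ≠ x) (hkx : G.Adj (f k) x)
    (huniq : ∀ y, G.Adj (f k) y → (∀ j ≤ k, f j ≠ y) → y = x) :
    IsInitialPath G v (Function.update f (k + 1) x) (k + 1) := by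
  have hl : Function.update f (k + 1) x (k + 1) = x := by simp
  have ho : ∀ i ≤ k, Function.update f (k + 1) x i = f i := fun i hi =>
    Function.update_of_ne (by omega) _ _
  have hix : ∀ i ≤ k, G.Adj (f i) x ↔ i = k := by
    intro i hi
    constructor
    · intro ha
      by_contra hne
      obtain ⟨j, hj, hjx⟩ := h.closed i (by omega) x ha
      exact hx j hj hjx
    · rintro rfl
      exact hkx
  refine ⟨by rw [ho 0 (by omega), h.zero], ?_, ?_, ?_⟩
  · intro i j hi hj hij
    rcases Nat.le_succ_iff.1 hi with hi | rfl <;> rcases Nat.le_succ_iff.1 hj with hj | rfl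
    · rw [ho i hi, ho j hj] at hij
      exact h.inj i j hi hj hij
    · rw [ho i hi, hl] at hij
      exact absurd hij (hx i hi)
    · rw [ho j hj, hl] at hij
      exact absurd hij.symm (hx j hj)
    · rfl
  · intro i j hi hj
    rcases Nat.le_succ_iff.1 hi with hi | rfl <;> rcases Nat.le_succ_iff.1 hj with hj | rfl
    · rw [ho i hi, ho j hj]
      exact h.adj i j hi hj
    · rw [ho i hi, hl, hix i hi]
      omega
    · rw [ho j hj, hl, G.adj_comm, hix j hj]
      omega
    · simp
  · intro i hi y hy
    rw [ho i (by omega)] at hy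
    by_cases hr : ∃ j ≤ k, f j = y
    · obtain ⟨j, hj, hjy⟩ := hr
      exact ⟨j, by omega, by rw [ho j hj, hjy]⟩
    · push Not at hr
      have hik : i = k := by
        by_contra hne
        obtain ⟨j, hj, hjy⟩ := h.closed i (by omega) y hy
        exact hr j hj hjy
      subst hik
      exact ⟨i + 1, le_rfl, by rw [hl, huniq y hy hr]⟩

theorem IsInitialPath.isPathGraph {V : Type*} {G : SimpleGraph V} {v : V} {f : ℕ → V} {k : ℕ}
    (h : IsInitialPath G v f k) (hs : ∀ x, ∃ j ≤ k, f j = x) : IsPathGraph G := by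
  refine ⟨k + 1, ⟨RelIso.symm ⟨Equiv.ofBijective (fun i : Fin (k + 1) => f i) ⟨?_, ?_⟩, ?_⟩⟩⟩
  · exact fun i j hij => Fin.ext (h.inj i j (by omega) (by omega) hij)
  · intro x
    obtain ⟨j, hj, hjx⟩ := hs x
    exact ⟨⟨j, by omega⟩, hjx⟩
  · intro i j
    rw [SimpleGraph.pathGraph_adj]
    exact h.adj i j (by omega) (by omega)

/-- A graph with a pendant vertex `v` that is not a path has a vector `z` as required in
`not_inGSSP_of_adjMatrix_mulVec`: it is supported exactly off a maximal initial path from `v`. -/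
theorem not_inGSSP_of_not_isPathGraph {V : Type*} [Fintype V] [DecidableEq V] {G : SimpleGraph V}
    [DecidableRel G.Adj] {v u : V} (hu : ∀ x, G.Adj v x ↔ x = u) (hG : ¬ IsPathGraph G) :
    ¬ InGSSP (dup G v) ∧ ¬ InGSSP (jdup G v) := by
  classical
  obtain ⟨k, ⟨f, hf⟩, hmax⟩ : ∃ k, (∃ f, IsInitialPath G v f k) ∧
      ∀ m, (∃ f, IsInitialPath G v f m) → m ≤ k := by
    have h0 : ∃ f, IsInitialPath G v f 0 :=
      ⟨fun _ => v, rfl, fun i j hi hj _ => by omega, fun i j hi hj => by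
        simp only [SimpleGraph.irrefl, false_iff]
        omega, fun i hi => by omega⟩
    have hb : ∀ m, (∃ f, IsInitialPath G v f m) → m ≤ Fintype.card V :=
      fun m ⟨f, hf⟩ => hf.lt_card.le
    refine ⟨Nat.findGreatest (fun m => ∃ f, IsInitialPath G v f m) (Fintype.card V),
      Nat.findGreatest_spec (P := fun m => ∃ f, IsInitialPath G v f m) (Nat.zero_le _) h0,
      fun m hm => Nat.le_findGreatest (hb m hm) hm⟩
  let S : Finset V := (Finset.range (k + 1)).image f
  have hS : ∀ x, x ∈ S ↔ ∃ j ≤ k, f j = x := by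
    intro x
    simp [S]
  let N : Finset V := Finset.univ.filter fun x => G.Adj (f k) x ∧ x ∉ S
  -- A unique neighbour of `f k` off the path would extend the path.
  have hN : N.card ≠ 1 := by
    intro h1
    obtain ⟨x, hx⟩ := Finset.card_eq_one.1 h1
    have hmem : ∀ y, (G.Adj (f k) y ∧ y ∉ S) ↔ y = x := by
      intro y
      rw [← Finset.mem_singleton, ← hx]
      simp [N]
    obtain ⟨hkx, hxS⟩ := (hmem x).2 rfl
    have := hmax (k + 1) ⟨_, hf.snoc (fun j hj h => hxS ((hS x).2 ⟨j, hj, h⟩)) hkx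
      fun y hy hyS => (hmem y).1 ⟨hy, fun h => by
        obtain ⟨j, hj, hjy⟩ := (hS y).1 h
        exact hyS j hj hjy⟩⟩
    omega
  have hk : k ≠ 0 := by
    rintro rfl
    apply hN
    rw [Finset.card_eq_one]
    refine ⟨u, ?_⟩
    ext x
    simp only [N, Finset.mem_filter, Finset.mem_univ, true_and, Finset.mem_singleton, hf.zero, hu,
      hS]
    constructor
    · exact fun h => h.1
    · rintro rfl
      refine ⟨rfl, ?_⟩
      rintro ⟨j, hj, hjx⟩
      obtain rfl : j = 0 := by omega
      have := (hu x).2 rfl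
      rw [← hjx, hf.zero] at this
      exact G.irrefl this
  obtain ⟨t, ht⟩ : ∃ t, t ∉ S := by
    by_contra! h
    exact hG (hf.isPathGraph fun x => (hS x).1 (h x))
  obtain ⟨b, hb, hbs⟩ := exists_ne_zero_sum_eq_zero N hN
  refine not_inGSSP_of_adjMatrix_mulVec (z := fun x => if x ∈ S then 0 else b x) ?_ ?_ ?_ ?_
  · intro h
    have := congrFun h t
    simp [ht, hb] at this
  · intro x hx
    have hxS : x ∈ S := by
      by_contra h
      simp [h, hb] at hx
    obtain ⟨i, hi, rfl⟩ := (hS x).1 hxS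
    rw [SimpleGraph.adjMatrix_mulVec_apply]
    rcases hi.eq_or_lt with rfl | hi
    · rw [Finset.sum_ite, Finset.sum_const_zero, zero_add, ← hbs]
      refine Finset.sum_congr ?_ fun _ _ => rfl
      ext y
      simp [N]
    · refine Finset.sum_eq_zero fun y hy => if_pos ((hS y).2 ?_)
      exact hf.closed i hi y ((G.mem_neighborFinset _ _).1 hy)
  · exact if_pos ((hS v).2 ⟨0, Nat.zero_le _, hf.zero⟩)
  · intro x hx
    rw [← hf.zero] at hx
    exact if_pos ((hS x).2 (hf.closed 0 (by omega) x hx))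

end SSPGraph

theorem mainTheorem2 {V : Type*} [Fintype V] [DecidableEq V] (G : SimpleGraph V)
    [DecidableRel G.Adj] (v : V) (hv : G.degree v = 1) :
    (SSPGraph.InGSSP (SSPGraph.dup G v) ↔ SSPGraph.IsPathGraph G) ∧
    (SSPGraph.InGSSP (SSPGraph.jdup G v) ↔ SSPGraph.IsPathGraph G) := by
  obtain ⟨u, hu⟩ : ∃ u, ∀ x, G.Adj v x ↔ x = u := by
    obtain ⟨u, hu⟩ := Finset.card_eq_one.1 hv
    exact ⟨u, fun x => by rw [← G.mem_neighborFinset, hu, Finset.mem_singleton]⟩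
  refine ⟨⟨fun h => ?_, fun h => ?_⟩, ⟨fun h => ?_, fun h => ?_⟩⟩
  · by_contra hG
    exact (SSPGraph.not_inGSSP_of_not_isPathGraph hu hG).1 h
  · obtain ⟨ℓ, hd, -⟩ := h.exists_isTwinLevel hu
    exact hd.inGSSP
  · by_contra hG
    exact (SSPGraph.not_inGSSP_of_not_isPathGraph hu hG).2 h
  · obtain ⟨ℓ, -, hj⟩ := h.exists_isTwinLevel hu
    exact hj.inGSSP
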